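/- Let $\mathbb H\neq\{0\}$ be a separable complex Hilbert space with a fixed complete orthonormal system $\{e_j\}$ (the ``real'' basis); a vector is called real if all its coordinates in $\{e_j\}$ are real. For a zero-mean, second-order stationary process $\{X(t),t\in\mathbb Z^d\}$, $d\ge 1$, with real values in $\mathbb H$, let $C(h)=\mathbb E[X(t+h)\otimes X(t)]$, $h\in\mathbb Z^d$, be its stationary covariance operator, where $(x\otimes y)(z)=\langle z,y\rangle x$. When $\sum_k\|C(k)\|_{\rm tr}<\infty$, its spectral density is $$f(\theta)=(2\pi)^{-d}\sum_{k\in\mathbb Z^d}C(k)\,e^{\mathrm i\,\theta^\top k}.$$ Here $\|\cdot\|_{\rm tr}$ and $\|\cdot\|_{\rm HS}$ are the trace and Hilbert--Schmidt norms of operators on $\mathbb H$. For $\beta,L>0$ let $\mathcal P_D(\beta,L)$ be the class of all such spectral densities $f$ for which $\sum_{k\in\mathbb Z^d}\|C(k)\|_{\rm tr}\,(1+\|k\|_2^\beta)\le L$. Let $\mathcal M_n$ be the class of all estimators $f_n$ of $f$ based on the observations $X(t)$, $t\in\{1,\dots,n\}^d$, that is, of all measurable functions of these observations with values in the operator-valued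 functions of $\theta$. \textbf{Theorem.} For every interior point $\theta_0\in(-\pi,\pi)^d$ and all $\beta,L>0$, $$\liminf_{n\to\infty}\ \inf_{f_n\in\mathcal M_n}\ \sup_{f\in\mathcal P_D(\beta,L)}\ \mathbb P_f\Big(\big\|f_n(\theta_0)-f(\theta_0)\big\|_{\rm HS}\ \ge\ n^{-\frac{d\beta}{2\beta+d}}\Big)>0,$$ where $\mathbb P_f$ is the law of the zero-mean stationary Gaussian process on $\mathbb Z^d$ with real values in $\mathbb H$ and spectral density $f$. -/

import Mathlib

open MeasureTheory ProbabilityTheory Filter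
open scoped ENNReal

noncomputable section

namespace SpectralMinimax

section Operators

variable {ι H : Type*} [NormedAddCommGroup H] [InnerProductSpace ℂ H] [CompleteSpace H]

/-- The trace norm `∑ⱼ ⟨(T⋆ T)^{1/2} eⱼ, eⱼ⟩` of a bounded operator, computed in the complete
orthonormal system `e`; it is `∞` if `T` is not of trace class. -/
def traceNorm (e : HilbertBasis ι ℂ H) (T : H →L[ℂ] H) : ℝ≥0∞ :=
  ∑' j, ENNReal.ofReal (inner ℂ (e j) (CFC.abs T (e j))).re

/-- The Hilbert–Schmidt norm `(∑ⱼ ‖T eⱼ‖²)^{1/2}` of a bounded operator; it is `∞` if `T` is not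
a Hilbert–Schmidt operator. -/
def hsNorm (e : HilbertBasis ι ℂ H) (T : H →L[ℂ] H) : ℝ≥0∞ :=
  (∑' j, ‖T (e j)‖ₑ ^ 2) ^ (1 / 2 : ℝ)

/-- A vector is real, with respect to the designated real complete orthonormal system `e`, if all
its coordinates are real numbers. -/
def IsRealVector (e : HilbertBasis ι ℂ H) (v : H) : Prop :=
  ∀ j, (inner ℂ (e j) v).im = 0

/-- The Fourier series `(2π)^{-d} ∑ₖ exp(i θᵀk) C(k)` of an operator-valued function on `ℤ^d`. -/
def spectralDensity {d : ℕ} (C : (Fin d → ℤ) → H →L[ℂ] H) (θ : Fin d → ℝ) : H →L[ℂ] H :=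
  (((2 * Real.pi) ^ d)⁻¹ : ℂ) •
    ∑' k : Fin d → ℤ, Complex.exp (Complex.I * ∑ i, (θ i : ℂ) * (k i : ℂ)) • C k

end Operators

section Processes

/-! A process `{X(t), t ∈ ℤ^d}` with values in `H` is given by its law `μ` on the space of paths
`ℤ^d → H`, so that `X(t)` is the evaluation of the path at `t`. -/

variable {d : ℕ} {ι H : Type*} [NormedAddCommGroup H] [InnerProductSpace ℂ H] [CompleteSpace H]
  [MeasurableSpace H]

/-- The covariance operator `C(t,s) = 𝔼[X(t) ⊗ X(s)]`, where `(x ⊗ y) z = ⟨z, y⟩ x`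
(a Bochner integral). -/
def covOp (μ : Measure ((Fin d → ℤ) → H)) (t s : Fin d → ℤ) : H →L[ℂ] H :=
  ∫ x, InnerProductSpace.rankOne ℂ (x t) (x s) ∂μ

/-- The stationary covariance operator `C(h) = C(h, 0)`. -/
def autocov (μ : Measure ((Fin d → ℤ) → H)) (h : Fin d → ℤ) : H →L[ℂ] H :=
  covOp μ h 0

/-- `μ` is the law of a zero-mean second-order stationary process taking real values in `H`.
(For a real process the covariance and the pseudo-covariance operators coincide.) -/
structure IsRealStationary (e : HilbertBasis ι ℂ H) (μ : Measure ((Fin d → ℤ) → H)) : Prop where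
  prob : IsProbabilityMeasure μ
  real : ∀ t, ∀ᵐ x ∂μ, IsRealVector e (x t)
  secondOrder : ∀ t, MemLp (fun x : (Fin d → ℤ) → H => x t) 2 μ
  zeroMean : ∀ t, ∫ x, x t ∂μ = 0
  stationary : ∀ t h, covOp μ (t + h) t = autocov μ h

/-- `μ` is the law of a zero-mean stationary Gaussian process with real values in `H` and with
spectral density `f`. -/
structure IsGaussianWithDensity (e : HilbertBasis ι ℂ H) (f : (Fin d → ℝ) → H →L[ℂ] H)
    (μ : Measure ((Fin d → ℤ) → H)) : Prop where
  stationary : IsRealStationary e μ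
  gaussian : IsGaussianProcess (fun (t : Fin d → ℤ) (x : (Fin d → ℤ) → H) => x t) μ
  summable : ∑' k, traceNorm e (autocov μ k) < ∞
  density : f = spectralDensity (autocov μ)

/-- The Euclidean norm of a lattice point. -/
def latticeNorm (k : Fin d → ℤ) : ℝ := √(∑ i, (k i : ℝ) ^ 2)

/-- The power-law class `𝒫_D(β, L)`: the spectral densities of those real stationary processes
whose covariance operators satisfy `∑ₖ ‖C(k)‖_tr (1 + ‖k‖₂^β) ≤ L`. -/
def powerLawClass (e : HilbertBasis ι ℂ H) (d : ℕ) (β L : ℝ) : Set ((Fin d → ℝ) → H →L[ℂ] H) :=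
  {f | ∃ C : (Fin d → ℤ) → H →L[ℂ] H,
    (∃ μ : Measure ((Fin d → ℤ) → H), IsRealStationary e μ ∧ ∀ k, C k = autocov μ k) ∧
    ∑' k, traceNorm e (C k) * ENNReal.ofReal (1 + latticeNorm k ^ β) ≤ ENNReal.ofReal L ∧
    f = spectralDensity C}

/-- The sampling sites `{1, …, n}^d`. -/
def grid (d n : ℕ) : Set (Fin d → ℤ) := {t | ∀ i, 1 ≤ t i ∧ t i ≤ n}

/-- The data `X(t)`, `t ∈ {1, …, n}^d`. -/
def observe (n : ℕ) (x : (Fin d → ℤ) → H) : grid d n → H := fun t => x t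

/-- The class `ℳ_n` of all estimators of the spectral density: all (weakly) measurable
functions of the data, with values in the operator-valued functions of the frequency `θ`. -/
def estimators (H : Type*) [NormedAddCommGroup H] [InnerProductSpace ℂ H] [MeasurableSpace H]
    (d n : ℕ) : Set ((grid d n → H) → (Fin d → ℝ) → H →L[ℂ] H) :=
  {φ | ∀ θ, ∀ u v : H, Measurable fun y => inner ℂ u (φ y θ v)}

/-- The minimax probability
`inf_{f_n ∈ ℳ_n} sup_{f ∈ 𝒫_D(β,L)} ℙ_f(‖f_n(θ₀) - f(θ₀)‖_HS ≥ r)`, where `ℙ_f` is the law of the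
stationary Gaussian process with spectral density `f`. -/
def minimaxProb (e : HilbertBasis ι ℂ H) (d : ℕ) (β L : ℝ) (θ₀ : Fin d → ℝ) (n : ℕ) (r : ℝ) :
    ℝ≥0∞ :=
  ⨅ φ ∈ estimators H d n, ⨆ f ∈ powerLawClass e d β L,
    ⨆ (μ : Measure ((Fin d → ℤ) → H)) (_ : IsGaussianWithDensity e f μ),
      μ {x | ENNReal.ofReal r ≤ hsNorm e (φ (observe n x) θ₀ - f θ₀)}

end Processes

end SpectralMinimax

end

/-! Le Cam's two-point method in a single direction `e j₀`. Under the null the process is `σ` times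
scalar white noise times `e j₀`. Under the alternative an independent moving average is added, with
scalar covariance `a cos(θᵀk) N(k)`, where `N(k)` counts the pairs in a cube of side `m` with
difference `k`; its spectral density is a pair of Fejér bumps at `±θ`.

Three quantities must balance. The height of the bump at `θ` is of order `a m^{2d}`
(`half_le_sum_pairCount_mul_cos_sq`). The bump costs at most `a m^{2d} (1 + (√d m)^β)` in the class
norm, up to `σ²` (`tsum_traceNorm_bumpLaw_le`). On `n^d` sites the squared Hilbert–Schmidt norm of
the added covariance matrix is at most `n^d a² m^{3d}` (`grid_comparison`), and by
`gaussian_comparison` this controls how well the two laws can be told apart. Taking `a ≍ m^{-2d-β}`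
and `m ≍ n^{d/(2β+d)}` keeps the last two bounded, while the separation is of order `m^{-β} ≍
n^{-dβ/(2β+d)}`. `two_point` turns this into a bound for every estimator. -/

noncomputable section

namespace SpectralMinimax

/-! ### Second moment comparison of Gaussian vectors -/

section GaussianComparison

open scoped NNReal Matrix

/-- The density of `N(0, 1)` with respect to `N(0, w)`. -/
def gaussianRatio (w : ℝ≥0) (x : ℝ) : ℝ≥0∞ :=
  ENNReal.ofReal (gaussianPDFReal 0 1 x / gaussianPDFReal 0 w x)

lemma measurable_gaussianRatio (w : ℝ≥0) : Measurable (gaussianRatio w) :=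
  ((measurable_gaussianPDFReal 0 1).div (measurable_gaussianPDFReal 0 w)).ennreal_ofReal

lemma gaussianReal_withDensity_gaussianRatio {w : ℝ≥0} (hw : w ≠ 0) :
    (gaussianReal 0 w).withDensity (gaussianRatio w) = gaussianReal 0 1 := by
  rw [gaussianReal_of_var_ne_zero 0 hw, gaussianReal_of_var_ne_zero 0 one_ne_zero,
    ← withDensity_mul _ (measurable_gaussianPDF 0 w) (measurable_gaussianRatio w)]
  congr 1
  ext x
  have h := gaussianPDFReal_pos 0 w x hw
  simp only [Pi.mul_apply, gaussianPDF, gaussianRatio]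
  rw [← ENNReal.ofReal_mul h.le]
  congr 1
  field_simp

/-- The integral equals `w / √(2w - 1)`, whose square is `1 + (w-1)²/(2w-1) ≤ exp((w-1)²)`. Taking
the ratio of the narrow law to the wide one keeps it square integrable for every `w ≥ 1`; the
reverse ratio would need `w < 2`. -/
lemma lintegral_gaussianRatio_sq_le {w : ℝ≥0} (hw : 1 ≤ w) :
    ∫⁻ x, gaussianRatio w x ^ 2 ∂(gaussianReal 0 w)
      ≤ ENNReal.ofReal (Real.exp (((w : ℝ) - 1) ^ 2 / 2)) := by
  have hw0 : w ≠ 0 := (zero_lt_one.trans_le hw).ne'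
  have hw1 : (1 : ℝ) ≤ w := by exact_mod_cast hw
  have hwp : (0 : ℝ) < w := by linarith
  set b : ℝ := 1 - 1 / (2 * w) with hb
  have hbpos : 0 < b := by
    have : 1 / (2 * (w : ℝ)) ≤ 1 / 2 := by
      apply one_div_le_one_div_of_le <;> linarith
    linarith
  set c : ℝ := √(w / (2 * Real.pi)) with hc
  have hfun : ∀ x : ℝ, gaussianPDF 0 w x * gaussianRatio w x ^ 2
      = ENNReal.ofReal (c * Real.exp (-b * x ^ 2)) := by
    intro x
    have h := gaussianPDFReal_pos 0 w x hw0
    have h1 := gaussianPDFReal_pos 0 1 x one_ne_zero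
    simp only [gaussianPDF, gaussianRatio]
    rw [← ENNReal.ofReal_pow (by positivity), ← ENNReal.ofReal_mul h.le]
    congr 1
    have : gaussianPDFReal 0 w x * (gaussianPDFReal 0 1 x / gaussianPDFReal 0 w x) ^ 2
      = gaussianPDFReal 0 1 x ^ 2 / gaussianPDFReal 0 w x := by field_simp
    rw [this, div_eq_iff h.ne']
    simp only [gaussianPDFReal, sub_zero, NNReal.coe_one, mul_one]
    have e1 : (√(2 * Real.pi))⁻¹ ^ 2 = c * (√(2 * Real.pi * w))⁻¹ := by
      rw [hc, inv_pow, Real.sq_sqrt (by positivity), ← Real.sqrt_inv, ← Real.sqrt_mul (by positivity)]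
      rw [eq_comm, Real.sqrt_eq_iff_mul_self_eq (by positivity) (by positivity)]
      field_simp
    have e2 : Real.exp (-x ^ 2 / 2) ^ 2
        = Real.exp (-b * x ^ 2) * Real.exp (-x ^ 2 / (2 * w)) := by
      rw [← Real.exp_add, ← Real.exp_nat_mul]
      congr 1
      rw [hb]; field_simp; push_cast; ring
    rw [mul_pow, e1, e2]
    ring
  have hint : Integrable fun x : ℝ => c * Real.exp (-b * x ^ 2) :=
    (integrable_exp_neg_mul_sq hbpos).const_mul c
  rw [gaussianReal_of_var_ne_zero 0 hw0,
    lintegral_withDensity_eq_lintegral_mul _ (measurable_gaussianPDF 0 w)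
      ((measurable_gaussianRatio w).pow_const 2)]
  simp only [Pi.mul_apply, hfun]
  rw [← ofReal_integral_eq_lintegral_ofReal hint
    (Eventually.of_forall fun x => by positivity), integral_const_mul, integral_gaussian]
  apply ENNReal.ofReal_le_ofReal
  rw [hc, ← Real.sqrt_mul (by positivity)]
  have key : (w : ℝ) / (2 * Real.pi) * (Real.pi / b) = 1 + (w - 1) ^ 2 / (2 * w - 1) := by
    have : (2 * (w : ℝ) - 1) ≠ 0 := by linarith
    have hb' : b = (2 * w - 1) / (2 * w) := by rw [hb]; field_simp
    rw [hb', show (w : ℝ) / (2 * Real.pi) * (Real.pi / ((2 * w - 1) / (2 * w)))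
      = w ^ 2 / (2 * w - 1) by field_simp, eq_comm, eq_div_iff this, add_mul,
      div_mul_cancel₀ _ this]
    ring
  rw [key]
  apply Real.sqrt_le_iff.2 ⟨(Real.exp_pos _).le, ?_⟩
  rw [← Real.exp_nat_mul]
  have h1 : ((w : ℝ) - 1) ^ 2 / (2 * w - 1) ≤ (w - 1) ^ 2 :=
    div_le_self (sq_nonneg _) (by linarith)
  have h2 := Real.add_one_le_exp (((w : ℝ) - 1) ^ 2)
  have h3 : ((2 : ℕ) : ℝ) * (((w : ℝ) - 1) ^ 2 / 2) = (w - 1) ^ 2 := by push_cast; ring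
  rw [h3]; linarith

variable {κ : Type*} [Fintype κ]

lemma lintegral_pi_prod (q : κ → Measure ℝ) [∀ i, IsProbabilityMeasure (q i)]
    {g : κ → ℝ → ℝ≥0∞} (hg : ∀ i, Measurable (g i)) :
    ∫⁻ y, ∏ i, g i (y i) ∂(Measure.pi q) = ∏ i, ∫⁻ x, g i x ∂(q i) := by
  have hind : iIndepFun (fun i (y : κ → ℝ) => g i (y i)) (Measure.pi q) :=
    iIndepFun_pi fun i => (hg i).aemeasurable
  rw [lintegral_prod_eq_prod_lintegral_of_indepFun Finset.univ _ hind
    fun i => (hg i).comp (measurable_pi_apply i)]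
  refine Finset.prod_congr rfl fun i _ => ?_
  exact (measurePreserving_eval q i).lintegral_comp (hg i)

lemma pi_withDensity_prod (q p : κ → Measure ℝ) [∀ i, IsProbabilityMeasure (q i)]
    [∀ i, IsProbabilityMeasure (p i)]
    {g : κ → ℝ → ℝ≥0∞} (hg : ∀ i, Measurable (g i)) (h : ∀ i, (q i).withDensity (g i) = p i) :
    (Measure.pi q).withDensity (fun y => ∏ i, g i (y i)) = Measure.pi p := by
  symm
  refine Measure.pi_eq fun s hs => ?_
  rw [withDensity_apply _ (MeasurableSet.univ_pi hs),
    ← lintegral_indicator (MeasurableSet.univ_pi hs)]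
  have : ∀ y : κ → ℝ, (Set.univ.pi s).indicator (fun y => ∏ i, g i (y i)) y
      = ∏ i, (s i).indicator (g i) (y i) := by
    intro y
    by_cases hy : y ∈ Set.univ.pi s
    · rw [Set.indicator_of_mem hy]
      exact Finset.prod_congr rfl fun i _ => (Set.indicator_of_mem (hy i trivial) _).symm
    · rw [Set.indicator_of_notMem hy]
      obtain ⟨i, hi⟩ : ∃ i, y i ∉ s i := by simpa [Set.mem_pi] using hy
      exact (Finset.prod_eq_zero (Finset.mem_univ i) (Set.indicator_of_notMem hi _)).symm
  simp only [this]
  rw [lintegral_pi_prod q fun i => (hg i).indicator (hs i)]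
  refine Finset.prod_congr rfl fun i _ => ?_
  rw [lintegral_indicator (hs i), ← withDensity_apply _ (hs i), h i]

/-- Cauchy–Schwarz applied to `F` and the indicator of `B`. -/
lemma withDensity_sq_le {α : Type*} [MeasurableSpace α] (q : Measure α) {F : α → ℝ≥0∞}
    (hF : Measurable F) {B : Set α} (hB : MeasurableSet B) :
    (q.withDensity F B) ^ 2 ≤ (∫⁻ x, F x ^ 2 ∂q) * q B := by
  rw [withDensity_apply _ hB, ← lintegral_indicator hB]
  have e : ∀ x, B.indicator F x = F x * B.indicator 1 x := by
    intro x; by_cases hx : x ∈ B <;> simp [hx]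
  have h := ENNReal.lintegral_mul_le_Lp_mul_Lq q Real.HolderConjugate.two_two hF.aemeasurable
    ((measurable_one.indicator hB : Measurable (B.indicator (1 : α → ℝ≥0∞))).aemeasurable)
  simp only [Pi.mul_apply] at h
  simp only [e]
  have e2 : ∀ x, (B.indicator (1 : α → ℝ≥0∞) x) ^ (2 : ℝ) = B.indicator 1 x := by
    intro x; by_cases hx : x ∈ B <;> simp [hx]
  simp only [e2, lintegral_indicator_one hB] at h
  calc _ ≤ ((∫⁻ x, F x ^ (2 : ℝ) ∂q) ^ (1 / 2 : ℝ) * q B ^ (1 / 2 : ℝ)) ^ 2 := by gcongr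
    _ = _ := by
      rw [mul_pow, ← ENNReal.rpow_natCast, ← ENNReal.rpow_natCast, ← ENNReal.rpow_mul,
        ← ENNReal.rpow_mul]
      norm_num

lemma pi_gaussianReal_sq_le {w : κ → ℝ≥0} (hw : ∀ i, 1 ≤ w i) {B : Set (κ → ℝ)}
    (hB : MeasurableSet B) :
    (Measure.pi (fun _ : κ => gaussianReal 0 1) B) ^ 2 ≤
      ENNReal.ofReal (Real.exp (∑ i, ((w i : ℝ) - 1) ^ 2 / 2)) *
        Measure.pi (fun i => gaussianReal 0 (w i)) B := by
  have hg : ∀ i, Measurable (gaussianRatio (w i)) := fun i => measurable_gaussianRatio (w i)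
  rw [← pi_withDensity_prod (fun i => gaussianReal 0 (w i)) _ hg fun i =>
    gaussianReal_withDensity_gaussianRatio (zero_lt_one.trans_le (hw i)).ne']
  refine (withDensity_sq_le _ (by fun_prop) hB).trans ?_
  gcongr
  simp only [← Finset.prod_pow]
  rw [lintegral_pi_prod _ fun i => (hg i).pow_const 2, Real.exp_sum,
    ENNReal.ofReal_prod_of_nonneg fun i _ => (Real.exp_pos _).le]
  exact Finset.prod_le_prod' fun i _ => lintegral_gaussianRatio_sq_le (hw i)

variable {Ω : Type*} [MeasurableSpace Ω] {P : Measure Ω}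

/-- The rotated coordinates are jointly Gaussian and uncorrelated, hence independent, so their
variances determine the joint law. -/
lemma map_mulVec_gaussian [DecidableEq κ] {ξ : κ → Ω → ℝ}
    (hξ : HasGaussianLaw (fun ω t => ξ t ω) P) (h0 : ∀ t, ∫ ω, ξ t ω ∂P = 0)
    {S U : Matrix κ κ ℝ} (hS : ∀ t s, ∫ ω, ξ t ω * ξ s ω ∂P = S t s) {v : κ → ℝ}
    (hU : Uᵀ * S * U = Matrix.diagonal v) :
    P.map (fun ω => Uᵀ *ᵥ (fun t => ξ t ω)) =
      Measure.pi (fun i => gaussianReal 0 (v i).toNNReal) := by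
  have := hξ.isProbabilityMeasure
  set Y : κ → Ω → ℝ := fun i ω => (Uᵀ *ᵥ (fun t => ξ t ω)) i with hY
  have hYG : HasGaussianLaw (fun ω i => Y i ω) P :=
    hξ.map_fun (LinearMap.toContinuousLinearMap (Matrix.mulVecLin Uᵀ))
  have hξ2 : ∀ t, MemLp (ξ t) 2 P := fun t => (hξ.eval t).memLp_two
  have hYs : ∀ i ω, Y i ω = ∑ t, U t i * ξ t ω := fun i ω => by
    simp [hY, Matrix.mulVec, dotProduct]
  have hY0 : ∀ i, ∫ ω, Y i ω ∂P = 0 := fun i => by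
    simp only [hYs]
    rw [integral_finsetSum _ fun t _ => ((hξ2 t).integrable one_le_two).const_mul _]
    simp [integral_const_mul, h0]
  have hYY : ∀ i j, ∫ ω, Y i ω * Y j ω ∂P = Matrix.diagonal v i j := fun i j => by
    rw [← hU]
    simp only [hYs, Finset.sum_mul_sum]
    have hint : ∀ t s, Integrable (fun ω => U t i * ξ t ω * (U s j * ξ s ω)) P := fun t s => by
      have := ((hξ2 t).integrable_mul (hξ2 s)).const_mul (U t i * U s j)
      refine this.congr (Eventually.of_forall fun ω => ?_)
      simp only [Pi.mul_apply]; ring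
    rw [integral_finsetSum _ fun t _ => integrable_finsetSum _ fun s _ => hint t s]
    simp_rw [integral_finsetSum _ fun s _ => hint _ s]
    simp only [Matrix.mul_apply, Matrix.transpose_apply, Finset.sum_mul]
    rw [Finset.sum_comm]
    refine Finset.sum_congr rfl fun s _ => Finset.sum_congr rfl fun t _ => ?_
    rw [← hS, mul_assoc, mul_comm _ (U s j), ← mul_assoc, ← integral_const_mul]
    exact integral_congr_ae (Eventually.of_forall fun ω => by ring)
  have hcov : ∀ i j, cov[Y i, Y j; P] = Matrix.diagonal v i j := fun i j => by
    rw [covariance_eq_sub (hYG.eval i).memLp_two (hYG.eval j).memLp_two]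
    simp [hY0, hYY]
  have hind : iIndepFun Y P := hYG.iIndepFun_of_covariance_eq_zero fun i j hij => by
    rw [hcov, Matrix.diagonal_apply_ne _ hij]
  have hmap := (iIndepFun_iff_map_fun_eq_pi_map fun i => (hYG.eval i).aemeasurable).1 hind
  refine hmap.trans ?_
  congr 1
  ext1 i
  rw [(hYG.eval i).map_eq_gaussianReal, hY0,
    ← covariance_self (hYG.eval i).aemeasurable, hcov, Matrix.diagonal_apply_eq]

/-- A second moment comparison of two centered Gaussian vectors, one of which is white. -/
lemma gaussian_comparison [DecidableEq κ] {ξ η : κ → Ω → ℝ}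
    (hξ : HasGaussianLaw (fun ω t => ξ t ω) P) (hη : HasGaussianLaw (fun ω t => η t ω) P)
    (hξ0 : ∀ t, ∫ ω, ξ t ω ∂P = 0) (hη0 : ∀ t, ∫ ω, η t ω ∂P = 0)
    {T : Matrix κ κ ℝ} (hT : T.PosSemidef)
    (hξc : ∀ t s, ∫ ω, ξ t ω * ξ s ω ∂P = (1 : Matrix κ κ ℝ) t s)
    (hηc : ∀ t s, ∫ ω, η t ω * η s ω ∂P = (1 + T) t s)
    {B : Set (κ → ℝ)} (hB : MeasurableSet B) :
    (P {ω | (fun t => ξ t ω) ∈ B}) ^ 2 ≤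
      ENNReal.ofReal (Real.exp ((∑ t, ∑ s, T t s ^ 2) / 2)) * P {ω | (fun t => η t ω) ∈ B} := by
  -- One orthogonal `U` diagonalizes both covariances `1` and `1 + T`, so the comparison reduces to
  -- product measures with variances `1` and `1 + l i ≥ 1`.
  set U : Matrix κ κ ℝ := (hT.1.eigenvectorUnitary : Matrix κ κ ℝ)
  set l := hT.1.eigenvalues with hl
  have hstar : star U = Uᵀ := by simp [Matrix.star_eq_conjTranspose]
  have hU1 : Uᵀ * U = 1 := by rw [← hstar]; exact Unitary.coe_star_mul_self _
  have hU2 : U * Uᵀ = 1 := by rw [← hstar]; exact Unitary.coe_mul_star_self _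
  have hUT : Uᵀ * T * U = Matrix.diagonal l := by
    have h := hT.1.conjStarAlgAut_star_eigenvectorUnitary
    rw [Unitary.conjStarAlgAut_star_apply] at h
    rw [← hstar]
    exact h
  have hTsq : ∑ t, ∑ s, T t s ^ 2 = ∑ i, l i ^ 2 := by
    have h1 : ∑ t, ∑ s, T t s ^ 2 = (T * T).trace := by
      simp only [Matrix.trace, Matrix.diag, Matrix.mul_apply]
      refine Finset.sum_congr rfl fun t _ => Finset.sum_congr rfl fun s _ => ?_
      have := hT.1.apply t s
      simp only [star_trivial] at this
      rw [this, sq]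
    have h2 : (T * T).trace = (Uᵀ * T * U * (Uᵀ * T * U)).trace := by
      have : Uᵀ * T * U * (Uᵀ * T * U) = Uᵀ * (T * T * U) := by
        calc _ = Uᵀ * T * (U * Uᵀ) * T * U := by simp only [Matrix.mul_assoc]
          _ = _ := by rw [hU2]; simp only [Matrix.mul_assoc, Matrix.mul_one]
      rw [this, Matrix.trace_mul_comm Uᵀ, Matrix.mul_assoc (T * T), hU2, Matrix.mul_one]
    rw [h1, h2, hUT, Matrix.diagonal_mul_diagonal, Matrix.trace_diagonal]
    simp only [sq]
  have hl0 : ∀ i, 0 ≤ l i := hT.eigenvalues_nonneg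
  have hm0 := map_mulVec_gaussian hξ hξ0 (S := 1) (U := U) (v := fun _ => 1) hξc
    (by rw [Matrix.mul_one, hU1, Matrix.diagonal_one])
  have hm1 := map_mulVec_gaussian hη hη0 (S := 1 + T) (U := U) (v := fun i => 1 + l i) hηc
    (by rw [Matrix.mul_add, Matrix.add_mul, Matrix.mul_one, hU1, hUT, ← Matrix.diagonal_one,
      Matrix.diagonal_add])
  set B' : Set (κ → ℝ) := {y | U *ᵥ y ∈ B} with hB'
  have hB'm : MeasurableSet B' := by
    refine hB.preimage ?_
    exact (LinearMap.toContinuousLinearMap (Matrix.mulVecLin U)).measurable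
  have key : ∀ ζ : κ → Ω → ℝ, HasGaussianLaw (fun ω t => ζ t ω) P →
      P {ω | (fun t => ζ t ω) ∈ B} = P.map (fun ω => Uᵀ *ᵥ (fun t => ζ t ω)) B' := by
    intro ζ hζ
    rw [Measure.map_apply_of_aemeasurable _ hB'm]
    · congr 1
      ext ω
      simp [hB', Matrix.mulVec_mulVec, hU2]
    · exact (LinearMap.toContinuousLinearMap (Matrix.mulVecLin Uᵀ)).measurable.comp_aemeasurable
        hζ.aemeasurable
  rw [key ξ hξ, key η hη, hm0, hm1]
  have h := pi_gaussianReal_sq_le (w := fun i => (1 + l i).toNNReal)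
    (fun i => by rw [← NNReal.coe_le_coe, Real.coe_toNNReal _ (by linarith [hl0 i])]; simp [hl0 i])
    hB'm
  simp only [Real.toNNReal_one]
  convert h using 5
  rw [hTsq, Finset.sum_div]
  refine Finset.sum_congr rfl fun i _ => ?_
  rw [Real.coe_toNNReal _ (by linarith [hl0 i])]
  ring

end GaussianComparison

/-! ### Filtered white noise and its covariance -/

section Filters

variable {d : ℕ}

/-- The discrete cube `{0, …, m - 1}^d`. -/
def cube (d m : ℕ) : Finset (Fin d → ℤ) := Fintype.piFinset fun _ => Finset.Ico 0 (m : ℤ)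

lemma card_cube (d m : ℕ) : (cube d m).card = m ^ d := by simp [cube]

lemma zero_mem_cube {m : ℕ} (hm : 1 ≤ m) : (0 : Fin d → ℤ) ∈ cube d m := by
  simp only [cube, Fintype.mem_piFinset, Finset.mem_Ico, Pi.zero_apply, le_refl, true_and]
  intro _; omega

/-- The inner product `θᵀk`. -/
def phase (θ : Fin d → ℝ) (k : Fin d → ℤ) : ℝ := ∑ i, θ i * k i

lemma phase_sub (θ : Fin d → ℝ) (j k : Fin d → ℤ) : phase θ (j - k) = phase θ j - phase θ k := by
  simp [phase, mul_sub]

/-- The number of pairs in the cube with a given difference. -/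
def pairCount (d m : ℕ) (k : Fin d → ℤ) : ℝ :=
  ∑ j ∈ cube d m, ∑ j' ∈ cube d m, if j - j' = k then 1 else 0

lemma pairCount_nonneg (m : ℕ) (k : Fin d → ℤ) : 0 ≤ pairCount d m k :=
  Finset.sum_nonneg fun _ _ => Finset.sum_nonneg fun _ _ => by split_ifs <;> norm_num

lemma pairCount_le (m : ℕ) (k : Fin d → ℤ) : pairCount d m k ≤ (m : ℝ) ^ d := by
  calc pairCount d m k ≤ ∑ j ∈ cube d m, (1 : ℝ) := by
        refine Finset.sum_le_sum fun j _ => ?_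
        have : ∀ j', (j - j' = k) ↔ j' = j - k := fun j' => by
          constructor <;> rintro rfl <;> abel
        simp only [this, Finset.sum_ite_eq']
        split_ifs <;> norm_num
    _ = (m : ℝ) ^ d := by simp [card_cube]

lemma sum_pairCount_mul (m : ℕ) {S : Finset (Fin d → ℤ)}
    (hS : ∀ j ∈ cube d m, ∀ j' ∈ cube d m, j - j' ∈ S) (g : (Fin d → ℤ) → ℝ) :
    ∑ k ∈ S, pairCount d m k * g k = ∑ j ∈ cube d m, ∑ j' ∈ cube d m, g (j - j') := by
  simp only [pairCount, Finset.sum_mul]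
  rw [Finset.sum_comm]
  refine Finset.sum_congr rfl fun j hj => ?_
  rw [Finset.sum_comm]
  refine Finset.sum_congr rfl fun j' hj' => ?_
  simp [hS j hj j' hj']

/-- The cube `{-m, …, m}^d`. -/
def symCube (d m : ℕ) : Finset (Fin d → ℤ) := Fintype.piFinset fun _ => Finset.Icc (-m : ℤ) m

lemma sub_mem_symCube {m : ℕ} {j j' : Fin d → ℤ} (hj : j ∈ cube d m) (hj' : j' ∈ cube d m) :
    j - j' ∈ symCube d m := by
  simp only [cube, symCube, Fintype.mem_piFinset, Finset.mem_Ico, Finset.mem_Icc,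
    Pi.sub_apply] at *
  intro i
  have := hj i; have := hj' i
  omega

lemma pairCount_eq_zero {m : ℕ} {k : Fin d → ℤ} (hk : k ∉ symCube d m) :
    pairCount d m k = 0 :=
  Finset.sum_eq_zero fun _ hj => Finset.sum_eq_zero fun _ hj' =>
    if_neg fun h => hk (by rw [← h]; exact sub_mem_symCube hj hj')

lemma sum_pairCount (m : ℕ) : ∑ k ∈ symCube d m, pairCount d m k = (m : ℝ) ^ (2 * d) := by
  have := sum_pairCount_mul m (fun j hj j' hj' => sub_mem_symCube (d := d) hj hj') fun _ => 1
  simp only [mul_one] at this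
  rw [this]
  simp [card_cube, two_mul, pow_add]

/-- Write `cos² = (1 + cos 2·)/2`. The oscillating part is `|∑ⱼ exp(2iθᵀj)|² ≥ 0`: the mirror bump
at `-θ` can only add to the peak at `θ`. -/
lemma half_le_sum_pairCount_mul_cos_sq (m : ℕ) (θ : Fin d → ℝ) :
    (m : ℝ) ^ (2 * d) / 2 ≤ ∑ k ∈ symCube d m, pairCount d m k * Real.cos (phase θ k) ^ 2 := by
  have h2 : ∑ k ∈ symCube d m, pairCount d m k * Real.cos (2 * phase θ k) =
      (∑ j ∈ cube d m, Real.cos (2 * phase θ j)) ^ 2 +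
        (∑ j ∈ cube d m, Real.sin (2 * phase θ j)) ^ 2 := by
    rw [sum_pairCount_mul m (fun j hj j' hj' => sub_mem_symCube (d := d) hj hj')
      fun k => Real.cos (2 * phase θ k), sq, sq, Finset.sum_mul_sum, Finset.sum_mul_sum,
      ← Finset.sum_add_distrib]
    refine Finset.sum_congr rfl fun j _ => ?_
    rw [← Finset.sum_add_distrib]
    refine Finset.sum_congr rfl fun j' _ => ?_
    rw [phase_sub, mul_sub, Real.cos_sub]
  have h3 : ∑ k ∈ symCube d m, pairCount d m k * Real.cos (phase θ k) ^ 2 =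
      (∑ k ∈ symCube d m, pairCount d m k) / 2 +
        (∑ k ∈ symCube d m, pairCount d m k * Real.cos (2 * phase θ k)) / 2 := by
    rw [Finset.sum_div, Finset.sum_div, ← Finset.sum_add_distrib]
    refine Finset.sum_congr rfl fun k _ => ?_
    rw [Real.cos_sq]; ring
  rw [h3, h2, sum_pairCount]
  have := sq_nonneg (∑ j ∈ cube d m, Real.cos (2 * phase θ j))
  have := sq_nonneg (∑ j ∈ cube d m, Real.sin (2 * phase θ j))
  linarith

/-- One factor is at most `m^d`; the other sums to at most `m^{2d}`, since each pair of the cube is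
counted for at most one `s`. -/
lemma sum_pairCount_sub_sq_le (m : ℕ) (S : Finset (Fin d → ℤ)) (t : Fin d → ℤ) :
    ∑ s ∈ S, pairCount d m (t - s) ^ 2 ≤ (m : ℝ) ^ (3 * d) := by
  calc ∑ s ∈ S, pairCount d m (t - s) ^ 2
      ≤ ∑ s ∈ S, (m : ℝ) ^ d * pairCount d m (t - s) := by
        refine Finset.sum_le_sum fun s _ => ?_
        rw [sq]
        exact mul_le_mul_of_nonneg_right (pairCount_le m _) (pairCount_nonneg m _)
    _ = (m : ℝ) ^ d * ∑ j ∈ cube d m, ∑ j' ∈ cube d m, ∑ s ∈ S, if j - j' = t - s then 1 else 0 := by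
        rw [← Finset.mul_sum]
        simp only [pairCount]
        rw [Finset.sum_comm]
        congr 1
        refine Finset.sum_congr rfl fun j _ => ?_
        rw [Finset.sum_comm]
    _ ≤ (m : ℝ) ^ d * ∑ j ∈ cube d m, ∑ j' ∈ cube d m, (1 : ℝ) := by
        gcongr with j _ j' _
        have : ∀ s, (j - j' = t - s) ↔ s = t - (j - j') := fun s => by
          constructor
          · intro h; rw [h]; abel
          · rintro rfl; abel
        simp only [this, Finset.sum_ite_eq']
        split_ifs <;> norm_num
    _ = (m : ℝ) ^ (3 * d) := by
        simp only [Finset.sum_const, card_cube, nsmul_eq_mul]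
        push_cast
        ring

/-- A linear filter with three independent inputs and coefficients supported in a cube. -/
def filtered {Ω : Type*} (m : ℕ) (b : Fin 3 → (Fin d → ℤ) → ℝ)
    (W : Fin 3 × (Fin d → ℤ) → Ω → ℝ) (t : Fin d → ℤ) (ω : Ω) : ℝ :=
  ∑ p ∈ Finset.univ ×ˢ cube d m, b p.1 p.2 * W (p.1, t - p.2) ω

/-- The autocovariance of a filtered white noise. -/
def filterCov (m : ℕ) (b : Fin 3 → (Fin d → ℤ) → ℝ) (k : Fin d → ℤ) : ℝ :=
  ∑ j ∈ cube d m, ∑ j' ∈ cube d m, if j - j' = k then ∑ r, b r j * b r j' else 0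

/-- The filter producing white noise of variance `x²` plus an independent moving average whose
spectral density concentrates around `±θ`. -/
def bumpFilter (θ : Fin d → ℝ) (x a : ℝ) : Fin 3 → (Fin d → ℤ) → ℝ :=
  ![fun j => if j = 0 then x else 0, fun j => √a * Real.cos (phase θ j),
    fun j => √a * Real.sin (phase θ j)]

/-- The cosine and sine inputs combine by `cos u cos v + sin u sin v = cos(u - v)`, so each product
depends on `j - j'` alone and the sum collapses to a multiple of `pairCount`. -/
lemma filterCov_bumpFilter {m : ℕ} (hm : 1 ≤ m) (θ : Fin d → ℝ) (x : ℝ) {a : ℝ} (ha : 0 ≤ a)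
    (k : Fin d → ℤ) :
    filterCov m (bumpFilter θ x a) k =
      (if k = 0 then x ^ 2 else 0) + a * Real.cos (phase θ k) * pairCount d m k := by
  have h : ∀ j j' : Fin d → ℤ,
      (if j - j' = k then ∑ r, bumpFilter θ x a r j * bumpFilter θ x a r j' else 0) =
        (if j' = 0 then if j = 0 then if k = 0 then x ^ 2 else 0 else 0 else 0) +
          a * Real.cos (phase θ k) * (if j - j' = k then 1 else 0) := by
    intro j j'
    by_cases hk : j - j' = k
    · rw [if_pos hk, if_pos hk, ← hk, phase_sub, Real.cos_sub]
      have hs := Real.mul_self_sqrt ha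
      simp only [bumpFilter, Fin.sum_univ_three, Matrix.cons_val_zero, Matrix.cons_val_one,
        Matrix.cons_val]
      have e : √a * Real.cos (phase θ j) * (√a * Real.cos (phase θ j')) +
          √a * Real.sin (phase θ j) * (√a * Real.sin (phase θ j')) =
          a * (Real.cos (phase θ j) * Real.cos (phase θ j') +
            Real.sin (phase θ j) * Real.sin (phase θ j')) := by
        linear_combination (Real.cos (phase θ j) * Real.cos (phase θ j') +
            Real.sin (phase θ j) * Real.sin (phase θ j')) * hs
      rw [add_assoc, e, mul_one]
      congr 1
      by_cases h1 : j = 0 <;> by_cases h2 : j' = 0 <;> simp [h1, h2, sq]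
    · rw [if_neg hk, if_neg hk]
      by_cases h1 : j = 0
      · by_cases h2 : j' = 0
        · have : k ≠ 0 := by rintro rfl; simp [h1, h2] at hk
          simp [this]
        · simp [h2]
      · simp [h1]
  simp only [filterCov, h, Finset.sum_add_distrib, pairCount, Finset.mul_sum]
  congr 1
  simp [zero_mem_cube hm]

variable {Ω : Type*} [MeasurableSpace Ω] {P : Measure Ω}

/-- A family of uncorrelated standardized jointly Gaussian variables. -/
structure IsGaussianNoise {κ : Type*} (W : κ → Ω → ℝ) (P : Measure Ω) : Prop where
  measurable : ∀ i, Measurable (W i)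
  gaussian : IsGaussianProcess W P
  mean : ∀ i, ∫ ω, W i ω ∂P = 0
  cov_self : ∀ i, ∫ ω, W i ω * W i ω ∂P = 1
  cov_ne : ∀ i j, i ≠ j → ∫ ω, W i ω * W j ω ∂P = 0

lemma exists_isGaussianNoise (κ : Type) : ∃ (Ω : Type) (_ : MeasurableSpace Ω) (P : Measure Ω)
    (W : κ → Ω → ℝ), IsProbabilityMeasure P ∧ IsGaussianNoise W P := by
  obtain ⟨Ω, mΩ, P, W, hm, hlaw, hind, hP⟩ := exists_iid κ (gaussianReal 0 1)
  have hG : ∀ i, HasGaussianLaw (W i) P := fun i => (hlaw i).hasGaussianLaw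
  have hmean : ∀ i, ∫ ω, W i ω ∂P = 0 := fun i => by
    have := (hlaw i).integral_eq
    simpa using this
  refine ⟨Ω, mΩ, P, W, hP, hm, ⟨fun I => ?_⟩, hmean, fun i => ?_, fun i j hij => ?_⟩
  · exact (hind.precomp Subtype.val_injective).hasGaussianLaw fun i => hG i
  · have h1 : Var[W i; P] = 1 := by
      rw [(hlaw i).variance_eq, variance_id_gaussianReal]; simp
    rw [variance_eq_sub (hG i).memLp_two, hmean] at h1
    simpa [sq] using h1
  · have := (hind.indepFun hij).integral_fun_mul_eq_mul_integral
      (hm i).aestronglyMeasurable (hm j).aestronglyMeasurable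
    rw [this, hmean, zero_mul]

variable {W : Fin 3 × (Fin d → ℤ) → Ω → ℝ}

lemma IsGaussianNoise.measurable_filtered (hW : IsGaussianNoise W P) (m : ℕ)
    (b : Fin 3 → (Fin d → ℤ) → ℝ) (t : Fin d → ℤ) : Measurable (filtered m b W t) :=
  Finset.measurable_fun_sum _ fun _ _ => (hW.measurable _).const_mul _

lemma IsGaussianNoise.isGaussianProcess_filtered (hW : IsGaussianNoise W P) (m : ℕ)
    (b : Fin 3 → (Fin d → ℤ) → ℝ) : IsGaussianProcess (filtered m b W) P := by
  classical
  refine hW.gaussian.of_isGaussianProcess fun t => ?_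
  set f : Fin 3 × (Fin d → ℤ) → Fin 3 × (Fin d → ℤ) := fun p => (p.1, t - p.2) with hf
  refine ⟨(Finset.univ ×ˢ cube d m).image f,
    ∑ p : ↥((Finset.univ : Finset (Fin 3)) ×ˢ cube d m),
      b p.1.1 p.1.2 • ContinuousLinearMap.proj ⟨f p.1, Finset.mem_image_of_mem f p.2⟩, fun ω => ?_⟩
  simp only [filtered, _root_.sum_apply, _root_.smul_apply,
    ContinuousLinearMap.proj_apply, smul_eq_mul, Finset.restrict]
  exact (Finset.sum_coe_sort (Finset.univ ×ˢ cube d m)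
    fun p => b p.1 p.2 * W (p.1, t - p.2) ω).symm

lemma IsGaussianNoise.memLp_two (hW : IsGaussianNoise W P) (i) : MemLp (W i) 2 P :=
  (hW.gaussian.hasGaussianLaw_eval i).memLp_two

lemma IsGaussianNoise.integral_filtered (hW : IsGaussianNoise W P) (m : ℕ)
    (b : Fin 3 → (Fin d → ℤ) → ℝ) (t : Fin d → ℤ) : ∫ ω, filtered m b W t ω ∂P = 0 := by
  have := hW.gaussian.isProbabilityMeasure
  simp only [filtered]
  rw [integral_finsetSum _ fun p _ => ((hW.memLp_two _).integrable one_le_two).const_mul _]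
  simp [integral_const_mul, hW.mean]

lemma IsGaussianNoise.integral_filtered_mul (hW : IsGaussianNoise W P) (m : ℕ)
    (b : Fin 3 → (Fin d → ℤ) → ℝ) (t s : Fin d → ℤ) :
    ∫ ω, filtered m b W t ω * filtered m b W s ω ∂P = filterCov m b (t - s) := by
  classical
  simp only [filtered, Finset.sum_mul_sum]
  have hint : ∀ p q : Fin 3 × (Fin d → ℤ), Integrable
      (fun ω => b p.1 p.2 * W (p.1, t - p.2) ω * (b q.1 q.2 * W (q.1, s - q.2) ω)) P := by
    intro p q
    refine (((hW.memLp_two (p.1, t - p.2)).integrable_mul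
      (hW.memLp_two (q.1, s - q.2))).const_mul (b p.1 p.2 * b q.1 q.2)).congr
      (Eventually.of_forall fun ω => ?_)
    simp only [Pi.mul_apply]; ring
  have hval : ∀ p q : Fin 3 × (Fin d → ℤ),
      ∫ ω, b p.1 p.2 * W (p.1, t - p.2) ω * (b q.1 q.2 * W (q.1, s - q.2) ω) ∂P =
        if q.1 = p.1 then if p.2 - q.2 = t - s then b p.1 p.2 * b p.1 q.2 else 0 else 0 := by
    intro p q
    have : ∀ ω, b p.1 p.2 * W (p.1, t - p.2) ω * (b q.1 q.2 * W (q.1, s - q.2) ω) =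
        b p.1 p.2 * b q.1 q.2 * (W (p.1, t - p.2) ω * W (q.1, s - q.2) ω) := fun ω => by ring
    simp only [this, integral_const_mul]
    -- Two noise variables coincide exactly when their channels agree and `p.2 - q.2 = t - s`;
    -- otherwise they are uncorrelated.
    by_cases h : q.1 = p.1
    · by_cases h' : p.2 - q.2 = t - s
      · have e : t - p.2 = s - q.2 := by
          have : t = p.2 - q.2 + s := by rw [h']; abel
          rw [this]; abel
        rw [h, e, hW.cov_self]; simp [h']
      · rw [hW.cov_ne]
        · simp [h']
        · intro he
          apply h'
          have : t - p.2 = s - q.2 := (Prod.ext_iff.1 he).2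
          have : t = s - q.2 + p.2 := by rw [← this]; abel
          rw [this]; abel
    · rw [hW.cov_ne, if_neg h, mul_zero]
      intro he; exact h (Prod.ext_iff.1 he).1.symm
  rw [integral_finsetSum _ fun p _ => integrable_finsetSum _ fun q _ => hint p q]
  simp_rw [integral_finsetSum _ fun q _ => hint _ q, hval, Finset.sum_product]
  simp only [filterCov]
  have e : ∀ (r : Fin 3) (j : Fin d → ℤ),
      ∑ r' : Fin 3, ∑ j' ∈ cube d m,
        (if r' = r then if j - j' = t - s then b r j * b r j' else 0 else 0) =
      ∑ j' ∈ cube d m, if j - j' = t - s then b r j * b r j' else 0 := by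
    intro r j
    rw [Finset.sum_comm]
    simp
  simp only [e]
  rw [Finset.sum_comm]
  refine Finset.sum_congr rfl fun j _ => ?_
  rw [Finset.sum_comm]
  refine Finset.sum_congr rfl fun j' _ => ?_
  split_ifs <;> simp

end Filters

/-! ### Null and alternative on the observation grid -/

section GridComparison

variable {d : ℕ} {Ω : Type*} [MeasurableSpace Ω] {P : Measure Ω}
  {W : Fin 3 × (Fin d → ℤ) → Ω → ℝ}

lemma grid_eq (d n : ℕ) :
    grid d n = ((Fintype.piFinset fun _ => Finset.Icc 1 (n : ℤ) : Finset (Fin d → ℤ)) :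
      Set (Fin d → ℤ)) := by
  ext t; simp [grid, Pi.le_def, forall_and]

lemma finite_grid (d n : ℕ) : (grid d n).Finite := by
  rw [grid_eq]; exact Finset.finite_toSet _

instance (d n : ℕ) : Fintype (grid d n) := (finite_grid d n).fintype

lemma card_grid (d n : ℕ) : Fintype.card (grid d n) = n ^ d := by
  rw [← Nat.card_eq_fintype_card, Nat.card_coe_set_eq, grid_eq, Set.ncard_coe_finset]
  simp

/-- The quadratic form at `x` is the second moment of `∑ t, x t * ζ(τ t)`, with `ζ` the filtered
process. -/
lemma IsGaussianNoise.posSemidef_filterCov (hW : IsGaussianNoise W P) (m : ℕ)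
    (b : Fin 3 → (Fin d → ℤ) → ℝ) {κ : Type*} [Fintype κ] (τ : κ → Fin d → ℤ) :
    (Matrix.of fun t s => filterCov m b (τ t - τ s) : Matrix κ κ ℝ).PosSemidef := by
  have hG := hW.isGaussianProcess_filtered m b
  have h2 : ∀ t, MemLp (filtered m b W t) 2 P := fun t => (hG.hasGaussianLaw_eval t).memLp_two
  refine Matrix.PosSemidef.of_dotProduct_mulVec_nonneg ?_ fun x => ?_
  · ext t s
    simp only [Matrix.conjTranspose_apply, Matrix.of_apply, star_trivial]
    rw [← hW.integral_filtered_mul, ← hW.integral_filtered_mul]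
    simp only [mul_comm]
  · have hint : ∀ t s, Integrable
        (fun ω => x t * filtered m b W (τ t) ω * (x s * filtered m b W (τ s) ω)) P := fun t s =>
      (((h2 (τ t)).integrable_mul (h2 (τ s))).const_mul (x t * x s)).congr
        (Eventually.of_forall fun ω => by simp only [Pi.mul_apply]; ring)
    have e : star x ⬝ᵥ (Matrix.of fun t s => filterCov m b (τ t - τ s) : Matrix κ κ ℝ).mulVec x =
        ∫ ω, (∑ t, x t * filtered m b W (τ t) ω) ^ 2 ∂P := by
      simp only [sq, Finset.sum_mul_sum]
      rw [integral_finsetSum _ fun t _ => integrable_finsetSum _ fun s _ => hint t s]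
      simp_rw [integral_finsetSum _ fun s _ => hint _ s]
      simp only [dotProduct, Matrix.mulVec, Finset.mul_sum, Matrix.of_apply, star_trivial]
      refine Finset.sum_congr rfl fun t _ => Finset.sum_congr rfl fun s _ => ?_
      rw [← hW.integral_filtered_mul, ← integral_mul_const, ← integral_const_mul]
      exact integral_congr_ae (Eventually.of_forall fun ω => by ring)
    rw [e]
    exact integral_nonneg fun ω => sq_nonneg _

/-- Observed on a grid, the filtered process is not far from white noise in the second moment
sense. -/
lemma IsGaussianNoise.grid_comparison (hW : IsGaussianNoise W P) {m : ℕ} (hm : 1 ≤ m) (n : ℕ)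
    (θ : Fin d → ℝ) {a : ℝ} (ha : 0 ≤ a) {B : Set (grid d n → ℝ)} (hB : MeasurableSet B) :
    (P {ω | (fun t : grid d n => filtered m (bumpFilter θ 1 0) W t ω) ∈ B}) ^ 2 ≤
      ENNReal.ofReal (Real.exp ((n : ℝ) ^ d * (a ^ 2 * (m : ℝ) ^ (3 * d)) / 2)) *
        P {ω | (fun t : grid d n => filtered m (bumpFilter θ 1 a) W t ω) ∈ B} := by
  classical
  have hlaw : ∀ b, HasGaussianLaw (fun ω (t : grid d n) => filtered m b W t ω) P := fun b => by
    have h := (hW.isGaussianProcess_filtered m b).hasGaussianLaw (finite_grid d n).toFinset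
    exact h.map_fun (ContinuousLinearMap.pi fun t : grid d n =>
      ContinuousLinearMap.proj (φ := fun _ => ℝ)
        (⟨t.1, (finite_grid d n).mem_toFinset.2 t.2⟩ : ↥(finite_grid d n).toFinset))
  have hsub : ∀ t s : grid d n, ((t : Fin d → ℤ) - s = 0) ↔ t = s := fun t s => by
    rw [sub_eq_zero, Subtype.ext_iff]
  have h := gaussian_comparison (hlaw (bumpFilter θ 1 0)) (hlaw (bumpFilter θ 1 a))
    (fun t => hW.integral_filtered m _ t) (fun t => hW.integral_filtered m _ t)
    -- With the white part switched off (`x = 0`), the filter realizes the perturbation `T` itself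
    -- as a covariance matrix.
    (hW.posSemidef_filterCov m (bumpFilter θ 0 a) (fun t : grid d n => (t : Fin d → ℤ)))
    (fun t s => by
      rw [hW.integral_filtered_mul, filterCov_bumpFilter hm θ 1 le_rfl]
      simp [hsub, Matrix.one_apply])
    (fun t s => by
      rw [hW.integral_filtered_mul, filterCov_bumpFilter hm θ 1 ha]
      simp [hsub, Matrix.one_apply, filterCov_bumpFilter hm θ 0 ha])
    hB
  refine h.trans ?_
  gcongr
  calc ∑ t : grid d n, ∑ s : grid d n,
        (Matrix.of (fun t s : grid d n =>
          filterCov m (bumpFilter θ 0 a) ((t : Fin d → ℤ) - s)) : Matrix _ _ ℝ) t s ^ 2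
      ≤ ∑ t : grid d n, a ^ 2 * (m : ℝ) ^ (3 * d) := by
        refine Finset.sum_le_sum fun t _ => ?_
        have h1 : ∑ s : grid d n, pairCount d m ((t : Fin d → ℤ) - s) ^ 2 ≤ (m : ℝ) ^ (3 * d) := by
          have := sum_pairCount_sub_sq_le (d := d) m (finite_grid d n).toFinset t
          rwa [Finset.sum_subtype _ fun x => (finite_grid d n).mem_toFinset] at this
        refine le_trans ?_ (mul_le_mul_of_nonneg_left h1 (sq_nonneg a))
        rw [Finset.mul_sum]
        refine Finset.sum_le_sum fun s _ => ?_
        rw [Matrix.of_apply, filterCov_bumpFilter hm θ 0 ha]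
        have hc : Real.cos (phase θ ((t : Fin d → ℤ) - s)) ^ 2 ≤ 1 := Real.cos_sq_le_one _
        have hN := sq_nonneg (a * pairCount d m ((t : Fin d → ℤ) - s))
        have e : ((if (t : Fin d → ℤ) - s = 0 then (0 : ℝ) ^ 2 else 0) +
            a * Real.cos (phase θ ((t : Fin d → ℤ) - s)) * pairCount d m ((t : Fin d → ℤ) - s)) ^ 2
            = Real.cos (phase θ ((t : Fin d → ℤ) - s)) ^ 2 *
              (a * pairCount d m ((t : Fin d → ℤ) - s)) ^ 2 := by
          simp; ring
        rw [e, ← mul_pow]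
        nlinarith
    _ = (n : ℝ) ^ d * (a ^ 2 * (m : ℝ) ^ (3 * d)) := by
        rw [Finset.sum_const, Finset.card_univ, card_grid, nsmul_eq_mul, Nat.cast_pow]

end GridComparison

/-! ### From real processes to processes in `H` -/

section Embedding

variable {d : ℕ} {ι H : Type*} [NormedAddCommGroup H] [InnerProductSpace ℂ H]
  {Ω : Type*} [MeasurableSpace Ω] {P : Measure Ω}

/-- The path in the direction `u` with real coefficients `σ ζ(t)`. -/
def embedPath (u : H) (σ : ℝ) (ζ : (Fin d → ℤ) → Ω → ℝ) (ω : Ω) (t : Fin d → ℤ) : H :=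
  ((σ * ζ t ω : ℝ) : ℂ) • u

variable [MeasurableSpace H] [BorelSpace H]

lemma measurable_embedPath (u : H) (σ : ℝ) {ζ : (Fin d → ℤ) → Ω → ℝ}
    (hζ : ∀ t, Measurable (ζ t)) : Measurable (embedPath u σ ζ) := by
  refine measurable_pi_lambda _ fun t => ?_
  have : Continuous fun x : ℝ => ((x : ℝ) : ℂ) • u := by fun_prop
  exact this.measurable.comp ((hζ t).const_mul σ)

variable [TopologicalSpace.SeparableSpace H]

lemma isGaussianProcess_embedPath (u : H) (σ : ℝ) {ζ : (Fin d → ℤ) → Ω → ℝ}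
    (hζ : ∀ t, Measurable (ζ t)) (hG : IsGaussianProcess ζ P) :
    IsGaussianProcess (fun (t : Fin d → ℤ) (x : (Fin d → ℤ) → H) => x t)
      (P.map (embedPath u σ ζ)) := by
  have : SecondCountableTopology H := UniformSpace.secondCountable_of_separable H
  have h : IsGaussianProcess (fun t ω => embedPath u σ ζ ω t) P := by
    refine hG.of_isGaussianProcess fun t => ⟨{t},
      (ContinuousLinearMap.proj ⟨t, Finset.mem_singleton_self t⟩ :
        ((i : ({t} : Finset (Fin d → ℤ))) → ℝ) →L[ℝ] ℝ).smulRight (σ • u), fun ω => ?_⟩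
    simp only [embedPath, ContinuousLinearMap.smulRight_apply, ContinuousLinearMap.proj_apply,
      Finset.restrict, Complex.coe_smul, smul_smul, mul_comm]
  refine ⟨fun I => ⟨?_⟩⟩
  rw [Measure.map_map (by fun_prop) (measurable_embedPath u σ hζ)]
  exact (h.hasGaussianLaw I).isGaussian_map

variable [CompleteSpace H]

lemma covOp_embedPath (u : H) (σ : ℝ) {ζ : (Fin d → ℤ) → Ω → ℝ}
    (hζ : ∀ t, Measurable (ζ t)) {γ : (Fin d → ℤ) → ℝ}
    (hγ : ∀ t s, ∫ ω, ζ t ω * ζ s ω ∂P = γ (t - s)) (t s : Fin d → ℤ) :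
    covOp (P.map (embedPath u σ ζ)) t s =
      ((σ ^ 2 * γ (t - s) : ℝ) : ℂ) • InnerProductSpace.rankOne ℂ u u := by
  have : SecondCountableTopology H := UniformSpace.secondCountable_of_separable H
  have hmeas : StronglyMeasurable fun x : (Fin d → ℤ) → H =>
      InnerProductSpace.rankOne ℂ (x t) (x s) := by
    have hc : Continuous fun p : H × H => InnerProductSpace.rankOne ℂ p.1 p.2 :=
      ((ContinuousLinearMap.smulRightL ℂ H H).continuous.comp
        ((innerSL ℂ).continuous.comp continuous_snd)).clm_apply continuous_fst
    have hts : StronglyMeasurable fun x : (Fin d → ℤ) → H => (x t, x s) :=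
      (measurable_pi_apply t).stronglyMeasurable.prodMk (measurable_pi_apply s).stronglyMeasurable
    exact hc.comp_stronglyMeasurable hts
  rw [covOp, integral_map (measurable_embedPath u σ hζ).aemeasurable hmeas.aestronglyMeasurable]
  have e : ∀ ω, InnerProductSpace.rankOne ℂ (embedPath u σ ζ ω t) (embedPath u σ ζ ω s) =
      (σ ^ 2 * (ζ t ω * ζ s ω)) • InnerProductSpace.rankOne ℂ u u := by
    intro ω
    ext z
    simp only [embedPath, InnerProductSpace.rankOne_apply, inner_smul_left, Complex.conj_ofReal,
      smul_smul, _root_.smul_apply, ← Complex.coe_smul]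
    congr 1
    push_cast; ring
  simp only [e]
  rw [integral_smul_const, integral_const_mul, hγ, Complex.coe_smul]

lemma isRealStationary_embedPath (e : HilbertBasis ι ℂ H) (j₀ : ι) (σ : ℝ)
    {ζ : (Fin d → ℤ) → Ω → ℝ}
    (hζ : ∀ t, Measurable (ζ t)) (hG : IsGaussianProcess ζ P) (h0 : ∀ t, ∫ ω, ζ t ω ∂P = 0)
    {γ : (Fin d → ℤ) → ℝ} (hγ : ∀ t s, ∫ ω, ζ t ω * ζ s ω ∂P = γ (t - s)) :
    IsRealStationary e (P.map (embedPath (e j₀) σ ζ)) := by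
  classical
  have : SecondCountableTopology H := UniformSpace.secondCountable_of_separable H
  have hGX := isGaussianProcess_embedPath (e j₀) σ hζ hG
  have hm := measurable_embedPath (e j₀) σ hζ
  refine ⟨hGX.isProbabilityMeasure, fun t => ?_, fun t => (hGX.hasGaussianLaw_eval t).memLp_two,
    fun t => ?_, fun t h => ?_⟩
  · have hset : MeasurableSet {v : H | IsRealVector e v} := by
      have : {v : H | IsRealVector e v} = ⋂ j, {v : H | (inner ℂ (e j) v).im = 0} := by
        ext v; simp [IsRealVector]
      rw [this]
      refine (isClosed_iInter fun j => isClosed_eq ?_ continuous_const).measurableSet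
      fun_prop
    rw [ae_map_iff (p := fun x => IsRealVector e (x t)) hm.aemeasurable
      (hset.preimage (measurable_pi_apply t))]
    refine Eventually.of_forall fun ω j => ?_
    rw [embedPath, inner_smul_right, orthonormal_iff_ite.1 e.orthonormal j j₀]
    split_ifs <;> simp
  · rw [integral_map hm.aemeasurable (measurable_pi_apply t).aestronglyMeasurable]
    simp only [embedPath]
    rw [integral_smul_const, integral_complex_ofReal, integral_const_mul, h0]
    simp
  · rw [autocov, covOp_embedPath _ _ hζ hγ, covOp_embedPath _ _ hζ hγ]
    simp

end Embedding

/-! ### Norms and spectral densities of rank one covariances -/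

section RankOne

variable {d : ℕ} {ι H : Type*} [NormedAddCommGroup H] [InnerProductSpace ℂ H] [CompleteSpace H]

/-- The projection is positive, hence its own absolute value, and only the `j₀` term of the trace
survives. -/
lemma traceNorm_smul_rankOne (e : HilbertBasis ι ℂ H) (j₀ : ι) (c : ℝ) :
    traceNorm e ((c : ℂ) • InnerProductSpace.rankOne ℂ (e j₀) (e j₀)) = ENNReal.ofReal |c| := by
  classical
  have hpos : (0 : H →L[ℂ] H) ≤ InnerProductSpace.rankOne ℂ (e j₀) (e j₀) :=
    (ContinuousLinearMap.nonneg_iff_isPositive _).2 (InnerProductSpace.isPositive_rankOne_self _)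
  rw [traceNorm, CFC.abs_smul, CFC.abs_of_nonneg _ hpos, tsum_eq_single j₀]
  · have := e.orthonormal.1 j₀
    simp [InnerProductSpace.rankOne_apply, this]
  · intro j hj
    simp [InnerProductSpace.rankOne_apply, e.orthonormal.2 hj.symm]

omit [CompleteSpace H] in
-- This reduces operator estimation to estimating one complex number, the `j₀` diagonal entry.
lemma enorm_inner_le_hsNorm (e : HilbertBasis ι ℂ H) (j₀ : ι) (T : H →L[ℂ] H) :
    ‖inner ℂ (e j₀) (T (e j₀))‖ₑ ≤ hsNorm e T := by
  have h1 : ‖inner ℂ (e j₀) (T (e j₀))‖ₑ ≤ ‖T (e j₀)‖ₑ := by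
    rw [enorm_le_iff_norm_le]
    refine (norm_inner_le_norm _ _).trans ?_
    rw [e.orthonormal.1, one_mul]
  refine h1.trans ?_
  calc ‖T (e j₀)‖ₑ = (‖T (e j₀)‖ₑ ^ 2) ^ (1 / 2 : ℝ) := by
        rw [← ENNReal.rpow_natCast, ← ENNReal.rpow_mul]; norm_num
    _ ≤ hsNorm e T := ENNReal.rpow_le_rpow (ENNReal.le_tsum (f := fun j => ‖T (e j)‖ₑ ^ 2) j₀)
        (by norm_num)

omit [CompleteSpace H] in
/-- The diagonal entry of a spectral density with finitely many rank one coefficients. -/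
lemma inner_spectralDensity (e : HilbertBasis ι ℂ H) (j₀ : ι) {c : (Fin d → ℤ) → ℝ}
    {S : Finset (Fin d → ℤ)} (hc : ∀ k ∉ S, c k = 0) (θ : Fin d → ℝ) :
    inner ℂ (e j₀) (spectralDensity (fun k =>
      (c k : ℂ) • InnerProductSpace.rankOne ℂ (e j₀) (e j₀)) θ (e j₀)) =
      (((2 * Real.pi) ^ d)⁻¹ : ℂ) * ∑ k ∈ S, Complex.exp (Complex.I * (phase θ k : ℝ)) * c k := by
  have hn := e.orthonormal.1 j₀
  rw [spectralDensity, tsum_eq_sum (s := S) fun k hk => by simp [hc k hk]]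
  simp only [_root_.smul_apply, _root_.sum_apply, inner_smul_right, inner_sum,
    InnerProductSpace.rankOne_apply, phase]
  simp [hn]

end RankOne

/-! ### The two hypotheses: class membership and separation -/

section BumpLaw

variable {d : ℕ} {ι H : Type*} [NormedAddCommGroup H] [InnerProductSpace ℂ H] [CompleteSpace H]
  [MeasurableSpace H] [BorelSpace H] [TopologicalSpace.SeparableSpace H]
  {Ω : Type*} [MeasurableSpace Ω] {P : Measure Ω} {W : Fin 3 × (Fin d → ℤ) → Ω → ℝ}

lemma filterCov_bumpFilter_eq_zero {m : ℕ} (hm : 1 ≤ m) (θ : Fin d → ℝ) {a : ℝ} (ha : 0 ≤ a)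
    {k : Fin d → ℤ} (hk : k ∉ symCube d m) : filterCov m (bumpFilter θ 1 a) k = 0 := by
  have h0 : k ≠ 0 := by
    rintro rfl
    exact hk (by simp [symCube])
  rw [filterCov_bumpFilter hm θ 1 ha, pairCount_eq_zero hk]
  simp [h0]

/-- The law of the process `σ ζ(t) e_{j₀}`, `ζ` being the white noise `W` passed through
`bumpFilter`. -/
def bumpLaw (e : HilbertBasis ι ℂ H) (j₀ : ι) (P : Measure Ω) (W : Fin 3 × (Fin d → ℤ) → Ω → ℝ)
    (σ : ℝ) (m : ℕ) (θ : Fin d → ℝ) (a : ℝ) : Measure ((Fin d → ℤ) → H) :=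
  P.map (embedPath (e j₀) σ (filtered m (bumpFilter θ 1 a) W))

lemma IsGaussianNoise.autocov_bumpLaw (hW : IsGaussianNoise W P) (e : HilbertBasis ι ℂ H) (j₀ : ι)
    (σ : ℝ) (m : ℕ) (θ : Fin d → ℝ) (a : ℝ) :
    autocov (bumpLaw e j₀ P W σ m θ a) = fun k =>
      ((σ ^ 2 * filterCov m (bumpFilter θ 1 a) k : ℝ) : ℂ) •
        InnerProductSpace.rankOne ℂ (e j₀) (e j₀) := by
  ext1 k
  rw [autocov, bumpLaw, covOp_embedPath _ _ (hW.measurable_filtered m _)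
    (hW.integral_filtered_mul m _), sub_zero]

lemma latticeNorm_le {m : ℕ} {k : Fin d → ℤ} (hk : k ∈ symCube d m) :
    latticeNorm k ≤ √d * m := by
  rw [latticeNorm]
  apply Real.sqrt_le_iff.2 ⟨by positivity, ?_⟩
  rw [mul_pow, Real.sq_sqrt (Nat.cast_nonneg d)]
  calc ∑ i, (k i : ℝ) ^ 2 ≤ ∑ _i : Fin d, (m : ℝ) ^ 2 := by
        refine Finset.sum_le_sum fun i _ => ?_
        simp only [symCube, Fintype.mem_piFinset, Finset.mem_Icc] at hk
        have h1 : (-(m : ℝ)) ≤ k i := by exact_mod_cast (hk i).1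
        have h2 : (k i : ℝ) ≤ m := by exact_mod_cast (hk i).2
        exact sq_le_sq' h1 h2
    _ = _ := by simp

lemma IsGaussianNoise.tsum_traceNorm_bumpLaw_le (hW : IsGaussianNoise W P)
    (e : HilbertBasis ι ℂ H) (j₀ : ι) {σ : ℝ} {m : ℕ} (hm : 1 ≤ m) (θ : Fin d → ℝ) {a β L : ℝ}
    (ha : 0 ≤ a) (hβ : 0 < β)
    (hL : σ ^ 2 * (1 + a * (m : ℝ) ^ (2 * d) * (1 + (√d * m) ^ β)) ≤ L) :
    ∑' k, traceNorm e (autocov (bumpLaw e j₀ P W σ m θ a) k) *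
      ENNReal.ofReal (1 + latticeNorm k ^ β) ≤ ENNReal.ofReal L := by
  simp only [hW.autocov_bumpLaw, traceNorm_smul_rankOne]
  have hln : ∀ k : Fin d → ℤ, 0 ≤ latticeNorm k := fun k => Real.sqrt_nonneg _
  have hw : ∀ k : Fin d → ℤ, 0 ≤ 1 + latticeNorm k ^ β := fun k => by
    have := Real.rpow_nonneg (hln k) β
    linarith
  rw [tsum_eq_sum (s := symCube d m) fun k hk => by simp [filterCov_bumpFilter_eq_zero hm θ ha hk]]
  simp only [← ENNReal.ofReal_mul (abs_nonneg _)]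
  rw [← ENNReal.ofReal_sum_of_nonneg fun k _ => mul_nonneg (abs_nonneg _) (hw k)]
  apply ENNReal.ofReal_le_ofReal
  refine le_trans ?_ hL
  have h0 : (0 : Fin d → ℤ) ∈ symCube d m := by simp [symCube]
  calc ∑ k ∈ symCube d m, |σ ^ 2 * filterCov m (bumpFilter θ 1 a) k| * (1 + latticeNorm k ^ β)
      ≤ ∑ k ∈ symCube d m, σ ^ 2 * ((if k = 0 then 1 else 0) +
          a * (pairCount d m k * (1 + (√d * m) ^ β))) := by
        refine Finset.sum_le_sum fun k hk => ?_
        rw [abs_mul, abs_of_nonneg (sq_nonneg σ), mul_assoc]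
        refine mul_le_mul_of_nonneg_left ?_ (sq_nonneg σ)
        rw [filterCov_bumpFilter hm θ 1 ha]
        have hN := pairCount_nonneg (d := d) m k
        have h1 : |a * Real.cos (phase θ k) * pairCount d m k| ≤ a * pairCount d m k := by
          rw [abs_mul, abs_mul, abs_of_nonneg ha, abs_of_nonneg hN]
          refine mul_le_mul_of_nonneg_right ?_ hN
          exact mul_le_of_le_one_right ha (Real.abs_cos_le_one _)
        have h2 : latticeNorm k ^ β ≤ (√d * m) ^ β :=
          Real.rpow_le_rpow (hln k) (latticeNorm_le hk) hβ.le
        have haN : 0 ≤ a * pairCount d m k := mul_nonneg ha hN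
        calc |(if k = 0 then (1 : ℝ) ^ 2 else 0) + a * Real.cos (phase θ k) * pairCount d m k| *
              (1 + latticeNorm k ^ β)
            ≤ ((if k = 0 then 1 else 0) + a * pairCount d m k) * (1 + latticeNorm k ^ β) := by
              refine mul_le_mul_of_nonneg_right ((abs_add_le _ _).trans (add_le_add ?_ h1)) (hw k)
              split_ifs <;> simp
          _ = (if k = 0 then 1 else 0) * (1 + latticeNorm k ^ β) +
                a * pairCount d m k * (1 + latticeNorm k ^ β) := add_mul _ _ _
          _ ≤ (if k = 0 then 1 else 0) + a * pairCount d m k * (1 + (√d * m) ^ β) := by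
              refine add_le_add ?_ (mul_le_mul_of_nonneg_left (by linarith) haN)
              -- At `k = 0` the weight is exactly `1`, because `0 ^ β = 0` for `β > 0`; the white
              -- part thus costs only `σ²`.
              split_ifs with hk0
              · subst hk0
                simp [latticeNorm, Real.zero_rpow hβ.ne']
              · simp
          _ = _ := by ring
    _ = σ ^ 2 * (1 + a * (m : ℝ) ^ (2 * d) * (1 + (√d * m) ^ β)) := by
        rw [← Finset.mul_sum, Finset.sum_add_distrib, ← Finset.mul_sum, ← Finset.sum_mul,
          sum_pairCount, Finset.sum_ite_eq', if_pos h0]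
        ring

lemma IsGaussianNoise.isRealStationary_bumpLaw (hW : IsGaussianNoise W P)
    (e : HilbertBasis ι ℂ H) (j₀ : ι) (σ : ℝ) (m : ℕ) (θ : Fin d → ℝ) (a : ℝ) :
    IsRealStationary e (bumpLaw e j₀ P W σ m θ a) :=
  isRealStationary_embedPath e j₀ σ (hW.measurable_filtered m _)
    (hW.isGaussianProcess_filtered m _) (hW.integral_filtered m _) (hW.integral_filtered_mul m _)

lemma IsGaussianNoise.spectralDensity_bumpLaw_mem (hW : IsGaussianNoise W P)
    (e : HilbertBasis ι ℂ H) (j₀ : ι) {σ : ℝ} {m : ℕ} (hm : 1 ≤ m) (θ : Fin d → ℝ) {a β L : ℝ}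
    (ha : 0 ≤ a) (hβ : 0 < β)
    (hL : σ ^ 2 * (1 + a * (m : ℝ) ^ (2 * d) * (1 + (√d * m) ^ β)) ≤ L) :
    spectralDensity (autocov (bumpLaw e j₀ P W σ m θ a)) ∈ powerLawClass e d β L :=
  ⟨_, ⟨_, hW.isRealStationary_bumpLaw e j₀ σ m θ a, fun _ => rfl⟩,
    hW.tsum_traceNorm_bumpLaw_le e j₀ hm θ ha hβ hL, rfl⟩

lemma IsGaussianNoise.isGaussianWithDensity_bumpLaw (hW : IsGaussianNoise W P)
    (e : HilbertBasis ι ℂ H) (j₀ : ι) {σ : ℝ} {m : ℕ} (hm : 1 ≤ m) (θ : Fin d → ℝ) {a : ℝ}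
    (ha : 0 ≤ a) :
    IsGaussianWithDensity e (spectralDensity (autocov (bumpLaw e j₀ P W σ m θ a)))
      (bumpLaw e j₀ P W σ m θ a) := by
  refine ⟨hW.isRealStationary_bumpLaw e j₀ σ m θ a,
    isGaussianProcess_embedPath (e j₀) σ (hW.measurable_filtered m _)
      (hW.isGaussianProcess_filtered m _), ?_, rfl⟩
  refine lt_of_le_of_lt ?_
    -- Only finiteness is needed, so the exponent `1` and the bound itself as radius will do.
    ((hW.tsum_traceNorm_bumpLaw_le e j₀ (σ := σ) hm θ ha one_pos le_rfl).trans_lt ENNReal.ofReal_lt_top)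
  refine ENNReal.tsum_le_tsum fun k => ?_
  refine le_mul_of_one_le_right' ?_
  rw [← ENNReal.ofReal_one]
  apply ENNReal.ofReal_le_ofReal
  have : 0 ≤ latticeNorm k := Real.sqrt_nonneg _
  simpa using this

/-- The two hypotheses are separated at the frequency `θ`. -/
lemma IsGaussianNoise.le_norm_inner_spectralDensity_sub (hW : IsGaussianNoise W P)
    (e : HilbertBasis ι ℂ H) (j₀ : ι) (σ : ℝ) {m : ℕ} (hm : 1 ≤ m) (θ : Fin d → ℝ) {a : ℝ}
    (ha : 0 ≤ a) :
    ((2 * Real.pi) ^ d)⁻¹ * (σ ^ 2 * (a * ((m : ℝ) ^ (2 * d) / 2))) ≤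
      ‖inner ℂ (e j₀) (spectralDensity (autocov (bumpLaw e j₀ P W σ m θ a)) θ (e j₀)) -
        inner ℂ (e j₀) (spectralDensity (autocov (bumpLaw e j₀ P W σ m θ 0)) θ (e j₀))‖ := by
  have hz : ∀ a : ℝ, 0 ≤ a → ∀ k ∉ symCube d m,
      σ ^ 2 * filterCov m (bumpFilter θ 1 a) k = 0 := fun a ha k hk => by
    rw [filterCov_bumpFilter_eq_zero hm θ ha hk, mul_zero]
  rw [hW.autocov_bumpLaw, hW.autocov_bumpLaw, inner_spectralDensity e j₀ (hz a ha),
    inner_spectralDensity e j₀ (hz 0 le_rfl), ← mul_sub, ← Finset.sum_sub_distrib]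
  have hterm : ∀ k, Complex.exp (Complex.I * (phase θ k : ℝ)) *
        ((σ ^ 2 * filterCov m (bumpFilter θ 1 a) k : ℝ) : ℂ) -
      Complex.exp (Complex.I * (phase θ k : ℝ)) *
        ((σ ^ 2 * filterCov m (bumpFilter θ 1 0) k : ℝ) : ℂ) =
      Complex.exp ((phase θ k : ℝ) * Complex.I) *
        ((σ ^ 2 * (a * (Real.cos (phase θ k) * pairCount d m k)) : ℝ) : ℂ) := fun k => by
    rw [← mul_sub, ← Complex.ofReal_sub, filterCov_bumpFilter hm θ 1 ha,
      filterCov_bumpFilter hm θ 1 le_rfl, mul_comm Complex.I]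
    congr 2
    ring
  simp only [hterm]
  rw [norm_mul]
  have hpi : ‖(((2 * Real.pi) ^ d)⁻¹ : ℂ)‖ = ((2 * Real.pi) ^ d)⁻¹ := by
    rw [norm_inv, norm_pow, norm_mul, Complex.norm_real, Complex.norm_two, Real.norm_eq_abs,
      abs_of_pos Real.pi_pos]
  rw [hpi]
  refine mul_le_mul_of_nonneg_left ?_ (by positivity)
  -- The real part suffices: `exp(iθᵀk)` contributes a second cosine, giving the `cos²` sum.
  refine le_trans ?_ (Complex.re_le_norm _)
  rw [Complex.re_sum]
  simp only [Complex.re_mul_ofReal, Complex.exp_ofReal_mul_I_re]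
  have := half_le_sum_pairCount_mul_cos_sq (d := d) m θ
  calc σ ^ 2 * (a * ((m : ℝ) ^ (2 * d) / 2))
      ≤ σ ^ 2 * (a * ∑ k ∈ symCube d m, pairCount d m k * Real.cos (phase θ k) ^ 2) := by gcongr
    _ = _ := by
      rw [Finset.mul_sum, Finset.mul_sum]
      exact Finset.sum_congr rfl fun k _ => by ring

end BumpLaw

/-! ### Reduction of the minimax risk to two hypotheses -/

section TwoPoint

/-- If both probabilities were smaller, then `P Aᶜ > 3/4`, whose square exceeds `1/4`, while `K * P
B < 1/4`. -/
lemma two_point {Ω : Type*} [MeasurableSpace Ω] {P : Measure Ω} [IsProbabilityMeasure P]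
    {A B : Set Ω} (hA : MeasurableSet A) {K : ℝ} (hK : 1 ≤ K)
    (h : (P Aᶜ) ^ 2 ≤ ENNReal.ofReal K * P B) :
    ENNReal.ofReal (1 / (4 * K)) ≤ P A ∨ ENNReal.ofReal (1 / (4 * K)) ≤ P B := by
  have hr : P.real Aᶜ ^ 2 ≤ K * P.real B := by
    have := ENNReal.toReal_mono (ENNReal.mul_ne_top ENNReal.ofReal_ne_top (measure_ne_top P B)) h
    rwa [ENNReal.toReal_pow, ENNReal.toReal_mul, ENNReal.toReal_ofReal (by linarith)] at this
  rw [ENNReal.ofReal_le_iff_le_toReal (measure_ne_top P A),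
    ENNReal.ofReal_le_iff_le_toReal (measure_ne_top P B)]
  change _ ≤ P.real A ∨ _ ≤ P.real B
  rw [probReal_compl_eq_one_sub hA] at hr
  by_contra! hc
  obtain ⟨h1, h2⟩ := hc
  have h3 : K * P.real B < 1 / 4 := by
    calc K * P.real B < K * (1 / (4 * K)) := by gcongr
      _ = 1 / 4 := by field_simp
  have h4 : 1 / (4 * K) ≤ 1 / 4 := by
    apply one_div_le_one_div_of_le <;> linarith
  nlinarith

variable {d : ℕ} {ι H : Type*} [NormedAddCommGroup H] [InnerProductSpace ℂ H] [CompleteSpace H]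
  [MeasurableSpace H] [BorelSpace H] [TopologicalSpace.SeparableSpace H]

/-- `hL` puts both hypotheses in the class, `hr` separates them by `2r` at `θ`, and `hK` keeps them
statistically close. -/
lemma le_minimaxProb (e : HilbertBasis ι ℂ H) (j₀ : ι) (d : ℕ) {β L σ : ℝ} (hβ : 0 < β)
    (θ : Fin d → ℝ) (n : ℕ) {m : ℕ} (hm : 1 ≤ m) {a r K : ℝ} (ha : 0 ≤ a)
    (hL : σ ^ 2 * (1 + a * (m : ℝ) ^ (2 * d) * (1 + (√d * m) ^ β)) ≤ L)
    (hr : 2 * r ≤ ((2 * Real.pi) ^ d)⁻¹ * (σ ^ 2 * (a * ((m : ℝ) ^ (2 * d) / 2))))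
    (hK : (n : ℝ) ^ d * (a ^ 2 * (m : ℝ) ^ (3 * d)) / 2 ≤ K) (hK0 : 0 ≤ K) :
    ENNReal.ofReal (1 / (4 * Real.exp K)) ≤ minimaxProb e d β L θ n r := by
  obtain ⟨Ω, _, P, W, hP, hW⟩ := exists_isGaussianNoise (Fin 3 × (Fin d → ℤ))
  set f : ℝ → (Fin d → ℝ) → H →L[ℂ] H :=
    fun a => spectralDensity (autocov (bumpLaw e j₀ P W σ m θ a)) with hf
  set z : ℝ → ℂ := fun a => inner ℂ (e j₀) (f a θ (e j₀)) with hz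
  refine le_iInf₂ fun φ hφ => ?_
  set g : (grid d n → ℝ) → grid d n → H := fun y t => ((σ * y t : ℝ) : ℂ) • e j₀ with hg
  have hgm : Measurable g := by
    refine measurable_pi_lambda _ fun t => ?_
    have : Continuous fun x : ℝ => ((σ * x : ℝ) : ℂ) • e j₀ := by fun_prop
    exact this.measurable.comp (measurable_pi_apply t)
  -- The error event is replaced by one about a matrix entry, which is measurable by weak
  -- measurability of `φ`.
  set B : ℝ → Set (grid d n → ℝ) :=
    fun b => {y | r ≤ ‖inner ℂ (e j₀) (φ (g y) θ (e j₀)) - z b‖} with hB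
  have hBm : ∀ b, MeasurableSet (B b) := fun b =>
    measurableSet_le measurable_const
      ((((hφ θ (e j₀) (e j₀)).comp hgm).sub_const (z b)).norm)
  set A : ℝ → Set Ω :=
    fun b => {ω | (fun t : grid d n => filtered m (bumpFilter θ 1 b) W t ω) ∈ B b} with hA
  have hFm : ∀ b, Measurable fun ω (t : grid d n) => filtered m (bumpFilter θ 1 b) W t ω :=
    fun b => measurable_pi_lambda _ fun t => hW.measurable_filtered m _ t
  -- Triangle inequality: an estimate within `r` of `z 0` is at least `r` away from `z a`.
  have hcompl : ∀ y, y ∉ B 0 → y ∈ B a := by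
    intro y hy
    simp only [hB, Set.mem_ofPred_eq, not_le] at hy ⊢
    have h1 := hr.trans (hW.le_norm_inner_spectralDensity_sub e j₀ σ hm θ ha)
    have h2 := norm_sub_le_norm_sub_add_norm_sub (z a)
      (inner ℂ (e j₀) (φ (g y) θ (e j₀))) (z 0)
    rw [norm_sub_rev (z a) (inner ℂ (e j₀) (φ (g y) θ (e j₀)))] at h2
    change 2 * r ≤ ‖z a - z 0‖ at h1
    linarith
  have hsup : ∀ b, 0 ≤ b → b ≤ a → P (A b) ≤ ⨆ f ∈ powerLawClass e d β L,
      ⨆ (μ : Measure ((Fin d → ℤ) → H)) (_ : IsGaussianWithDensity e f μ),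
        μ {x | ENNReal.ofReal r ≤ hsNorm e (φ (observe n x) θ - f θ)} := by
    intro b hb hba
    have hLb : σ ^ 2 * (1 + b * (m : ℝ) ^ (2 * d) * (1 + (√d * m) ^ β)) ≤ L :=
      le_trans (by gcongr) hL
    refine le_trans ?_ (le_iSup₂_of_le (f b)
      (hW.spectralDensity_bumpLaw_mem e j₀ hm θ hb hβ hLb)
      (le_iSup₂_of_le (bumpLaw e j₀ P W σ m θ b)
        (hW.isGaussianWithDensity_bumpLaw e j₀ hm θ hb) le_rfl))
    -- This inequality holds for arbitrary sets, so the Hilbert–Schmidt event need not be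
    -- measurable.
    refine le_trans ?_ (Measure.le_map_apply
      (measurable_embedPath (e j₀) σ (hW.measurable_filtered m _)).aemeasurable _)
    refine measure_mono fun ω hω => ?_
    simp only [Set.mem_preimage, Set.mem_ofPred_eq]
    refine le_trans ?_ (enorm_inner_le_hsNorm e j₀ _)
    rw [← ofReal_norm]
    apply ENNReal.ofReal_le_ofReal
    rw [_root_.sub_apply, inner_sub_right]
    exact hω
  have hcomp := hW.grid_comparison hm n θ ha (hBm 0).compl
  have h2 : (P (A 0)ᶜ) ^ 2 ≤ ENNReal.ofReal (Real.exp K) * P (A a) := by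
    refine hcomp.trans (mul_le_mul' ?_ (measure_mono fun ω hω => hcompl _ hω))
    exact ENNReal.ofReal_le_ofReal (Real.exp_le_exp.2 hK)
  rcases two_point ((hBm 0).preimage (hFm 0)) (Real.one_le_exp hK0) h2 with h | h
  · exact h.trans (hsup 0 le_rfl ha)
  · exact h.trans (hsup a ha le_rfl)

end TwoPoint

end SpectralMinimax

end

/-! ### Choice of the parameters -/

theorem mainTheorem2 {ι H : Type*} [NormedAddCommGroup H] [InnerProductSpace ℂ H]
    [CompleteSpace H] [TopologicalSpace.SeparableSpace H] [Nontrivial H]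
    [MeasurableSpace H] [BorelSpace H] (e : HilbertBasis ι ℂ H)
    (d : ℕ) (hd : 1 ≤ d) (θ₀ : Fin d → ℝ) (hθ₀ : ∀ i, θ₀ i ∈ Set.Ioo (-Real.pi) Real.pi)
    (β L : ℝ) (hβ : 0 < β) (hL : 0 < L) :
    0 < liminf (fun n : ℕ => SpectralMinimax.minimaxProb e d β L θ₀ n
      ((n : ℝ) ^ (-((d : ℝ) * β / (2 * β + d))))) atTop := by
  obtain ⟨j₀⟩ : Nonempty ι := by
    by_contra hne
    rw [not_nonempty_iff] at hne
    obtain ⟨x, hx⟩ := exists_ne (0 : H)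
    refine hx (e.repr.map_eq_zero_iff.1 ?_)
    ext i
    exact isEmptyElim i
  have hd0 : (0 : ℝ) < d := by exact_mod_cast hd
  -- With `m ≍ n^ρ`, the powers `m^{d+2β}` and `n^d` balance.
  set ρ : ℝ := d / (2 * β + d) with hρ
  have hρ0 : 0 < ρ := by positivity
  -- Makes the bump cost at most `1` before scaling; with `σ² = L/2` the total is then at most `L`.
  set α : ℝ := 1 / (1 + √d ^ β) with hα
  have hα0 : 0 < α := by positivity
  set G : ℝ := ((2 * Real.pi) ^ d)⁻¹ * (L / 4 * α) with hG
  have hG0 : 0 < G := by positivity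
  -- Solves `G * x ^ (-β) = 2 * n ^ (-dβ/(2β+d))` for `x = c * n ^ ρ`, the separation required with
  -- constant exactly `1` in the rate.
  set c : ℝ := (G / 2) ^ (1 / β) with hc
  have hc0 : 0 < c := by positivity
  set K : ℝ := α ^ 2 * (c / 2) ^ (-(d + 2 * β)) / 2 with hK
  have hK0 : 0 ≤ K := by positivity
  refine lt_of_lt_of_le (b := ENNReal.ofReal (1 / (4 * Real.exp K)))
    (ENNReal.ofReal_pos.2 (by positivity)) (le_liminf_of_le (by isBoundedDefault) ?_)
  have hlim : Tendsto (fun n : ℕ => c * (n : ℝ) ^ ρ) atTop atTop :=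
    ((tendsto_rpow_atTop hρ0).comp tendsto_natCast_atTop_atTop).const_mul_atTop hc0
  filter_upwards [hlim.eventually_ge_atTop 1, eventually_ge_atTop 1] with n hn hn1
  have hnp : (0 : ℝ) < n := by exact_mod_cast hn1
  set x : ℝ := c * (n : ℝ) ^ ρ with hx
  set m : ℕ := ⌊x⌋₊ with hm
  have hm1 : 1 ≤ m := Nat.one_le_floor_iff x |>.2 hn
  have hm1' : (1 : ℝ) ≤ m := by exact_mod_cast hm1
  have hmp : (0 : ℝ) < m := by linarith
  have hmle : (m : ℝ) ≤ x := Nat.floor_le (by positivity)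
  -- Since `m ≥ 1`, `x < m + 1 ≤ 2m`; this is the source of `c / 2` in `K`.
  have hmge : x / 2 ≤ m := by
    have := Nat.lt_floor_add_one x
    rw [← hm] at this
    linarith
  have hpow : ∀ k : ℕ, (m : ℝ) ^ k = (m : ℝ) ^ (k : ℝ) := fun k => (Real.rpow_natCast _ _).symm
  set a : ℝ := α * (m : ℝ) ^ (-(2 * d + β)) with ha
  have ha0 : 0 ≤ a := by positivity
  have ham : a * (m : ℝ) ^ (2 * d) = α * (m : ℝ) ^ (-β) := by
    rw [ha, hpow, mul_assoc, ← Real.rpow_add hmp]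
    congr 2
    push_cast; ring
  refine SpectralMinimax.le_minimaxProb e j₀ d (σ := √(L / 2)) hβ θ₀ n hm1 ha0 ?_ ?_ ?_ hK0
  · rw [Real.sq_sqrt (by positivity), ham, Real.mul_rpow (by positivity) (by positivity)]
    have h1 : (m : ℝ) ^ (-β) ≤ 1 := Real.rpow_le_one_of_one_le_of_nonpos hm1' (by linarith)
    have h2 : (m : ℝ) ^ (-β) * (m : ℝ) ^ β = 1 := by
      rw [← Real.rpow_add hmp]; simp
    have h3 : α * (m : ℝ) ^ (-β) * (1 + √d ^ β * (m : ℝ) ^ β) ≤ 1 := by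
      calc α * (m : ℝ) ^ (-β) * (1 + √d ^ β * (m : ℝ) ^ β)
          = α * ((m : ℝ) ^ (-β) + √d ^ β * ((m : ℝ) ^ (-β) * (m : ℝ) ^ β)) := by ring
        _ ≤ α * (1 + √d ^ β) := by rw [h2, mul_one]; gcongr
        _ = 1 := by rw [hα]; field_simp
    nlinarith
  · rw [Real.sq_sqrt (by positivity)]
    have e1 : ((2 * Real.pi) ^ d)⁻¹ * (L / 2 * (a * ((m : ℝ) ^ (2 * d) / 2))) =
        G * (m : ℝ) ^ (-β) := by
      rw [show a * ((m : ℝ) ^ (2 * d) / 2) = a * (m : ℝ) ^ (2 * d) / 2 by ring, ham, hG]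
      ring
    have e2 : x ^ (-β) = (G / 2)⁻¹ * (n : ℝ) ^ (-(d * β / (2 * β + d))) := by
      rw [hx, Real.mul_rpow hc0.le (by positivity), ← Real.rpow_mul hnp.le, hc,
        ← Real.rpow_mul (by positivity), ← Real.rpow_neg_one (G / 2)]
      congr 2
      · field_simp
      · rw [hρ]; ring
    have h1 : x ^ (-β) ≤ (m : ℝ) ^ (-β) :=
      Real.rpow_le_rpow_of_nonpos hmp hmle (by linarith)
    rw [e1]
    calc 2 * (n : ℝ) ^ (-(d * β / (2 * β + d))) = G * x ^ (-β) := by rw [e2]; field_simp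
      _ ≤ G * (m : ℝ) ^ (-β) := by gcongr
  · have e1 : a ^ 2 * (m : ℝ) ^ (3 * d) = α ^ 2 * (m : ℝ) ^ (-(d + 2 * β)) := by
      rw [ha, hpow, mul_pow, mul_assoc, ← Real.rpow_natCast ((m : ℝ) ^ _), ← Real.rpow_mul hmp.le,
        ← Real.rpow_add hmp]
      congr 2
      push_cast; ring
    have h1 : (m : ℝ) ^ (-(d + 2 * β)) ≤ (x / 2) ^ (-(d + 2 * β)) :=
      Real.rpow_le_rpow_of_nonpos (by positivity) hmge (by linarith)
    have e2 : (x / 2) ^ (-(d + 2 * β)) = (c / 2) ^ (-(d + 2 * β)) * ((n : ℝ) ^ d)⁻¹ := by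
      rw [hx, show c * (n : ℝ) ^ ρ / 2 = c / 2 * (n : ℝ) ^ ρ by ring,
        Real.mul_rpow (by positivity) (by positivity), ← Real.rpow_mul hnp.le,
        ← Real.rpow_natCast, ← Real.rpow_neg hnp.le]
      congr 2
      rw [hρ]; field_simp; ring
    rw [e1, hK]
    have h2 : (n : ℝ) ^ d * (α ^ 2 * (m : ℝ) ^ (-(d + 2 * β))) ≤
        α ^ 2 * (c / 2) ^ (-(d + 2 * β)) := by
      calc (n : ℝ) ^ d * (α ^ 2 * (m : ℝ) ^ (-(d + 2 * β)))
          ≤ (n : ℝ) ^ d * (α ^ 2 * ((c / 2) ^ (-(d + 2 * β)) * ((n : ℝ) ^ d)⁻¹)) := by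
            rw [← e2]; gcongr
        _ = _ := by field_simp
    linarith
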